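/- **Theorem (Ramsey-type theorem for decomposable metrics).** Definitions. Let $X$ be a finite non-empty metric space. A subspace $Y\subseteq X$ embeds in $L_p=L_p[0,1]$ with distortion $\alpha$ if there are $f:Y\to L_p$ and $r>0$ with $r\,d(u,v)\le\|f(u)-f(v)\|_p\le\alpha\, r\,d(u,v)$ for all $u,v\in Y$. The weighted Ramsey function $\Psi_{L_p}(X,\alpha)$ is the largest $\psi\in[0,1]$ such that for every weight function $w:X\to(0,\infty)$ there is a subspace $Y\subseteq X$ that embeds in $L_p$ with distortion $\alpha$ and satisfies $\sum_{x\in Y}w(x)^\psi\ge\big(\sum_{x\in X}w(x)\big)^\psi$. The space $X$ is $\tau$-decomposable if for every $\Delta>0$ there is a random partition of $X$ into clusters of diameter at most $\Delta$ such that, for each $x\in X$, with probability at least $1/2$ the closed ball of radius $\Delta/\tau$ around $x$ is contained in the cluster of $x$. The decomposability parameter $\tau_X$ is the infimum of the $\tau\ge1$ for which $X$ is $\tau$-decomposable. There is a universal constant $C>0$ such that the following holds for every finite non-empty metric space $X$, with $n=|X|$. 1. For every $1\le p<\infty$ and every $\alpha>1$, $$\Psi_{L_p}(X,\alpha)\ \ge\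 1-\Big(\frac{C\,\tau_X}{\alpha}\Big)^p\,p\,\log\Big(2+\frac{\alpha}{\tau_X}\Big).$$ 2. There is $C_X>0$, depending only on $X$, such that for every $1\le p<\infty$ and every $\alpha>1$, $$\Psi_{L_p}(X,\alpha)\ \ge\ 1-C_X\Big(\frac{\tau_X}{\alpha}\Big)^p\,p\,\log\Big(2+\frac{\alpha}{\tau_X}\Big).$$ 3. $\Psi_{L_\infty}(X,\alpha)=1$ for every $\alpha>1$. 4. For every $1\le p\le\infty$ and every $\varepsilon>0$, $X$ contains a subspace of size at least $n^{1-\varepsilon}$ that embeds in $L_p$ with distortion $$C\,\tau_X\Big(\frac{\log(2+1/\varepsilon)}{\varepsilon}\Big)^{1/p}=\tilde O\big(\tau_X/\varepsilon^{1/p}\big)$$ (with $1/p=0$ for $p=\infty$). -/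

import Mathlib

open MeasureTheory
open scoped ENNReal

noncomputable section

/-- The Banach space `L_p = L_p[0,1]` of real-valued functions. -/
abbrev LpSpace (p : ℝ≥0∞) : Type :=
  Lp ℝ p ((volume : Measure ℝ).restrict (Set.Icc 0 1))

/-- The subspace `Y` of `X` embeds into `L_p` with distortion at most `α`: some `f : Y → L_p`
satisfies, up to a scaling factor `r > 0`, `d(u,v) ≤ ‖f u - f v‖ / r ≤ α d(u,v)`; that is, the
ratio of the largest and the smallest value of `‖f u - f v‖ / d(u,v)` over pairs of distinct points
is at most `α`. -/
def EmbedsInLp {X : Type*} [MetricSpace X] (p : ℝ≥0∞) (α : ℝ) (Y : Finset X) : Prop :=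
  ∃ (f : Y → LpSpace p) (r : ℝ), 0 < r ∧ ∀ u v : Y,
    r * dist u v ≤ ‖f u - f v‖ ∧ ‖f u - f v‖ ≤ α * (r * dist u v)

/-- The exponents `ψ ∈ [0,1]` such that for every positive weight `w` on `X` there is a subspace `Y`
that `α`-embeds into `L_p` and has `∑_{x ∈ Y} w(x)^ψ ≥ (∑_{x ∈ X} w(x))^ψ`. -/
def ramseyExponents (X : Type*) [MetricSpace X] [Fintype X] (p : ℝ≥0∞) (α : ℝ) : Set ℝ :=
  {ψ | 0 ≤ ψ ∧ ψ ≤ 1 ∧ ∀ w : X → ℝ, (∀ x, 0 < w x) →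
    ∃ Y : Finset X, EmbedsInLp p α Y ∧ (∑ x, w x) ^ ψ ≤ ∑ x ∈ Y, w x ^ ψ}

/-- The weighted metric Ramsey function `Ψ_{L_p}(X, α)`: the largest Ramsey exponent. -/
def ramseyFunction (X : Type*) [MetricSpace X] [Fintype X] (p : ℝ≥0∞) (α : ℝ) : ℝ :=
  sSup (ramseyExponents X p α)

/-- `P`, a probability distribution on the partitions of `X` (given as equivalence relations), is
`Δ`-bounded (all clusters have diameter at most `Δ`) and `τ`-padded: for every point `x`, with
probability at least `1/2` the closed ball of radius `Δ/τ` around `x` lies in the cluster of `x`. -/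
def IsPaddedPartition {X : Type*} [MetricSpace X] (P : PMF (Setoid X)) (Δ τ : ℝ) : Prop :=
  (∀ s ∈ P.support, ∀ x y : X, s x y → dist x y ≤ Δ) ∧
  ∀ x : X, 1 / 2 ≤ P.toOuterMeasure {s | ∀ y ∈ Metric.closedBall x (Δ / τ), s x y}

/-- `X` is `τ`-decomposable if it has `τ`-padded probabilistic partitions at every scale. -/
def IsDecomposable (X : Type*) [MetricSpace X] (τ : ℝ) : Prop :=
  ∀ Δ : ℝ, 0 < Δ → ∃ P : PMF (Setoid X), IsPaddedPartition P Δ τ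

/-- The decomposability parameter `τ_X` (modulus of padded decomposability). The requirement
`1 ≤ τ` matters only for the one-point space: it is automatic if `X` has two points. -/
def decomposabilityParameter (X : Type*) [MetricSpace X] : ℝ :=
  sInf {τ : ℝ | 1 ≤ τ ∧ IsDecomposable X τ}

end

/-! Fix scales `r l = D / 9 ^ l`, with `D` at least half the diameter, and an integer `m ≥ 1`. The
plan is to find a heavy subset `Y` whose distances avoid `(2 r (l+1), 8 r (l+1)]` for all `l` in one
residue class modulo `m`; such a `Y` embeds in `L_p` with distortion `O(τ m ^ (1/p))`.

Heavy subset: carving balls at scale `l` multiplies the retained mass at `x` by at worst the ratio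
of the weights of the balls of radii `r (l+1)` and `r l` around `x` (`exists_gap_subset`). The
product of these ratios over all scales telescopes to at least `w x / W`, where `W` is the total
weight. Splitting it among the `m` residue classes and applying AM-GM, some class retains `∑ w ^ ψ ≥
W ^ ψ` with `ψ = 1 - 1/m` (`exists_heavy_gap_subset`).

Embedding: padded partitions at each scale give coordinates, namely truncated distances to
complements of clusters (`exists_cluster_weight`). Summed over all scales these could cost a factor
depending on their number. The gaps prevent this: before scale `l` is evaluated, points are
collapsed to representatives at the next gap scale, which lies fewer than `m` steps further. A pair
at scale `k` then gets nothing from `l ≤ k - m`, at most `O(d ^ p)` from each of the at most `m`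
scales up to `k`, and a geometric tail from finer ones, while scale `k` alone gives the lower bound
(`embedsInLp_of_gaps`).

Choosing `m` of order `(α / τ) ^ p`, or `m = ⌈1/ε⌉` with unit weights, gives the quantitative
bounds. The case `p = ∞` and the space-dependent bound use the Fréchet embedding. -/

lemma one_le_toReal {p : ℝ≥0∞} (hp : 1 ≤ p) (hp' : p ≠ ∞) : 1 ≤ p.toReal := by
  simpa using (ENNReal.toReal_le_toReal ENNReal.one_ne_top hp').2 hp

/-! ### Finite-dimensional spaces inside `L_p[0,1]` -/

/-- A measurable map from the line onto a finite type all of whose fibres meet `[0,1]` in positive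
measure. -/
lemma exists_measurable_fibres_pos (k : ℕ) (hk : 0 < k) :
    ∃ T : ℝ → Fin k, Measurable T ∧
      ∀ i, 0 < ((volume : Measure ℝ).restrict (Set.Icc 0 1)).map T {i} := by
  -- On `[0,1)` this is `⌊k t⌋`; the residue only forces the value into `Fin k`.
  refine ⟨fun t => ⟨⌊(k : ℝ) * t⌋₊ % k, Nat.mod_lt _ hk⟩, ?_, ?_⟩
  · exact (measurable_from_nat (f := fun j : ℕ => (⟨j % k, Nat.mod_lt _ hk⟩ : Fin k))).comp
      (Nat.measurable_floor.comp (measurable_const.mul measurable_id))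
  · intro i
    have hT : Measurable (fun t : ℝ => (⟨⌊(k : ℝ) * t⌋₊ % k, Nat.mod_lt _ hk⟩ : Fin k)) :=
      (measurable_from_nat (f := fun j : ℕ => (⟨j % k, Nat.mod_lt _ hk⟩ : Fin k))).comp
        (Nat.measurable_floor.comp (measurable_const.mul measurable_id))
    rw [Measure.map_apply hT (measurableSet_singleton i),
      Measure.restrict_apply (hT (measurableSet_singleton i))]
    have hk' : (0 : ℝ) < k := by exact_mod_cast hk
    have hsub : Set.Ico ((i : ℝ) / k) ((i + 1 : ℝ) / k) ⊆
        (fun t : ℝ => (⟨⌊(k : ℝ) * t⌋₊ % k, Nat.mod_lt _ hk⟩ : Fin k)) ⁻¹' {i} ∩ Set.Icc 0 1 := by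
      rintro t ⟨h1, h2⟩
      rw [div_le_iff₀ hk'] at h1
      rw [lt_div_iff₀ hk'] at h2
      have hi : ((i : ℕ) : ℝ) + 1 ≤ k := by exact_mod_cast i.2
      have hi0 : (0 : ℝ) ≤ ((i : ℕ) : ℝ) := Nat.cast_nonneg _
      have ht : 0 ≤ t := by
        by_contra h
        nlinarith
      refine ⟨?_, ht, by nlinarith⟩
      have : ⌊(k : ℝ) * t⌋₊ = i := by
        rw [Nat.floor_eq_iff (by positivity)]
        constructor <;> linarith
      simp [this, Nat.mod_eq_of_lt i.2]
    refine lt_of_lt_of_le ?_ (measure_mono hsub)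
    rw [Real.volume_Ico]
    simp only [ENNReal.ofReal_pos, sub_pos]
    gcongr
    linarith

lemma memLp_finite {k : ℕ} (ν : Measure (Fin k)) [IsFiniteMeasure ν] (p : ℝ≥0∞) (u : Fin k → ℝ) :
    MemLp u p ν := MemLp.of_discrete

/-- A finite-dimensional weighted `ℓ_p` space sits isometrically in `L_p[0,1]`. -/
lemma exists_lp_map_of_fin (k : ℕ) (p : ℝ≥0∞) (hp : 1 ≤ p) (hp' : p ≠ ∞) :
    ∃ Φ : (Fin k → ℝ) → LpSpace p, ∀ u v,
      ‖Φ u - Φ v‖ ^ p.toReal = ∑ i, |u i - v i| ^ p.toReal := by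
  rcases Nat.eq_zero_or_pos k with rfl | hk
  · refine ⟨fun _ => 0, fun u v => ?_⟩
    have : p.toReal ≠ 0 := (ENNReal.toReal_pos (by positivity) hp').ne'
    simp [Real.zero_rpow this]
  obtain ⟨T, hT, hpos⟩ := exists_measurable_fibres_pos k hk
  set μ := (volume : Measure ℝ).restrict (Set.Icc 0 1) with hμ
  have : IsFiniteMeasure μ := ⟨by simp [hμ]⟩
  set ν := μ.map T with hν
  have hp0 : 0 < p.toReal := ENNReal.toReal_pos (by positivity) hp'
  have hν0 : ∀ i, 0 < (ν {i}).toReal := fun i => ENNReal.toReal_pos (hpos i).ne' (measure_ne_top _ _)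
  -- The factor `ν {i} ^ (-1/p)` cancels the mass of the fibre over `i` in the integral, so the
  -- measures of the fibres need not be computed.
  let s : (Fin k → ℝ) → Fin k → ℝ := fun u i => u i * (ν {i}).toReal ^ (-(1 / p.toReal))
  have hmem : ∀ u, MemLp (s u ∘ T) p μ := fun u =>
    (memLp_finite ν p (s u)).comp_of_map hT.aemeasurable
  refine ⟨fun u => (hmem u).toLp, fun u v => ?_⟩
  have hs : s u ∘ T - s v ∘ T = s (u - v) ∘ T := by
    ext t; simp [s, sub_mul]
  rw [← MemLp.toLp_sub, Lp.norm_toLp, hs,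
    ← eLpNorm_map_measure (memLp_finite ν p _).aestronglyMeasurable hT.aemeasurable,
    eLpNorm_eq_lintegral_rpow_enorm_toReal (by positivity) hp', lintegral_fintype,
    ← ENNReal.toReal_rpow, ← Real.rpow_mul ENNReal.toReal_nonneg, one_div_mul_cancel hp0.ne',
    Real.rpow_one, ENNReal.toReal_sum]
  · refine Finset.sum_congr rfl fun i _ => ?_
    rw [ENNReal.toReal_mul, ← ENNReal.toReal_rpow, toReal_enorm, Real.norm_eq_abs]
    simp only [s, Pi.sub_apply, abs_mul]
    rw [abs_of_nonneg (Real.rpow_nonneg (hν0 i).le _), Real.mul_rpow (abs_nonneg _)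
      (Real.rpow_nonneg (hν0 i).le _), ← Real.rpow_mul (hν0 i).le, neg_mul,
      one_div_mul_cancel hp0.ne', Real.rpow_neg_one, mul_assoc, inv_mul_cancel₀ (hν0 i).ne', mul_one]
  · intro i _
    exact ENNReal.mul_ne_top (ENNReal.rpow_ne_top_of_nonneg hp0.le enorm_ne_top) (measure_ne_top _ _)

/-- Since every fibre of `T` has positive measure, the essential supremum of `|u ∘ T|` is the
maximum of `|u i|`. -/
lemma exists_linfty_map_of_fin (k : ℕ) (hk : 0 < k) :
    ∃ Φ : (Fin k → ℝ) → LpSpace ∞, ∀ u v, ‖Φ u - Φ v‖ = ‖u - v‖ := by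
  obtain ⟨T, hT, hpos⟩ := exists_measurable_fibres_pos k hk
  set μ := (volume : Measure ℝ).restrict (Set.Icc 0 1) with hμ
  have : IsFiniteMeasure μ := ⟨by simp [hμ]⟩
  set ν := μ.map T with hν
  have hmem : ∀ u : Fin k → ℝ, MemLp (u ∘ T) ∞ μ := fun u =>
    (memLp_finite ν ∞ u).comp_of_map hT.aemeasurable
  refine ⟨fun u => (hmem u).toLp, fun u v => ?_⟩
  have hs : u ∘ T - v ∘ T = (u - v) ∘ T := rfl
  rw [← MemLp.toLp_sub, Lp.norm_toLp, hs,
    ← eLpNorm_map_measure (memLp_finite ν ∞ _).aestronglyMeasurable hT.aemeasurable,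
    eLpNorm_exponent_top, eLpNormEssSup]
  have htop : ae ν = ⊤ := by
    rw [ae_eq_top]
    exact fun i => (hpos i).ne'
  have : Nonempty (Fin k) := ⟨⟨0, hk⟩⟩
  rw [essSup, htop, Filter.limsup_top_eq_iSup, ← toReal_enorm (u - v)]
  congr 1
  apply le_antisymm
  · refine iSup_le fun i => ?_
    rw [enorm_le_iff_norm_le]
    exact norm_le_pi_norm (u - v) i
  · obtain ⟨i, -, hi⟩ := Finset.exists_max_image Finset.univ (fun i => ‖(u - v) i‖)
      Finset.univ_nonempty
    refine le_trans ?_ (le_iSup _ i)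
    rw [enorm_le_iff_norm_le]
    exact (pi_norm_le_iff_of_nonneg (norm_nonneg _)).2 fun j => hi j (Finset.mem_univ j)

/-! ### Embeddings by coordinates and the Fréchet embedding -/

section Embedding

variable {X : Type*} [MetricSpace X]

/-- To embed `Y` into `L_p`, it suffices to give finitely many weighted coordinates. -/
lemma embedsInLp_of_coords {ι : Type*} [Fintype ι] {p : ℝ≥0∞} (hp : 1 ≤ p) (hp' : p ≠ ∞) {α r : ℝ}
    (hα : 0 ≤ α) (hr : 0 < r) {Y : Finset X} (q : ι → ℝ) (hq : ∀ i, 0 ≤ q i) (φ : Y → ι → ℝ)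
    (hlow : ∀ u v : Y, (r * dist u v) ^ p.toReal ≤ ∑ i, q i * |φ u i - φ v i| ^ p.toReal)
    (hupp : ∀ u v : Y, ∑ i, q i * |φ u i - φ v i| ^ p.toReal ≤ (α * (r * dist u v)) ^ p.toReal) :
    EmbedsInLp p α Y := by
  have hp0 : 0 < p.toReal := ENNReal.toReal_pos (by positivity) hp'
  obtain ⟨Φ, hΦ⟩ := exists_lp_map_of_fin (Fintype.card ι) p hp hp'
  let e := Fintype.equivFin ι
  refine ⟨fun u => Φ fun j => q (e.symm j) ^ (1 / p.toReal) * φ u (e.symm j), r, hr, fun u v => ?_⟩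
  have key : ‖Φ (fun j => q (e.symm j) ^ (1 / p.toReal) * φ u (e.symm j)) -
      Φ (fun j => q (e.symm j) ^ (1 / p.toReal) * φ v (e.symm j))‖ ^ p.toReal =
      ∑ i, q i * |φ u i - φ v i| ^ p.toReal := by
    rw [hΦ, ← Equiv.sum_comp e]
    refine Finset.sum_congr rfl fun i _ => ?_
    rw [e.symm_apply_apply, ← mul_sub, abs_mul, abs_of_nonneg (Real.rpow_nonneg (hq i) _),
      Real.mul_rpow (Real.rpow_nonneg (hq i) _) (abs_nonneg _), ← Real.rpow_mul (hq i),
      one_div_mul_cancel hp0.ne', Real.rpow_one]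
  have hd : 0 ≤ dist u v := dist_nonneg
  have : Fact (1 ≤ p) := ⟨hp⟩
  exact ⟨(Real.rpow_le_rpow_iff (by positivity) (norm_nonneg _) hp0).1 (key ▸ hlow u v),
    (Real.rpow_le_rpow_iff (norm_nonneg _) (by positivity) hp0).1 (key ▸ hupp u v)⟩

/-- Fréchet's isometry: the distances to all points are 1-Lipschitz coordinates, and the coordinate
of `v` attains `d(u,v)`. -/
lemma embedsInLp_top [Fintype X] [Nonempty X] {α : ℝ} (hα : 1 ≤ α) (Y : Finset X) :
    EmbedsInLp ∞ α Y := by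
  obtain ⟨Φ, hΦ⟩ := exists_linfty_map_of_fin (Fintype.card X) Fintype.card_pos
  let e := Fintype.equivFin X
  refine ⟨fun u => Φ fun j => dist (u : X) (e.symm j), 1, one_pos, fun u v => ?_⟩
  have h : ‖Φ (fun j => dist (u : X) (e.symm j)) - Φ (fun j => dist (v : X) (e.symm j))‖ =
      dist u v := by
    rw [hΦ]
    apply le_antisymm
    · rw [pi_norm_le_iff_of_nonneg dist_nonneg]
      intro j
      exact abs_dist_sub_le _ _ _
    · have := norm_le_pi_norm ((fun j => dist (u : X) (e.symm j)) -
        (fun j => dist (v : X) (e.symm j))) (e v)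
      simpa [Subtype.dist_eq] using this
  rw [h]
  have hd : 0 ≤ dist u v := dist_nonneg
  exact ⟨by linarith, by nlinarith⟩

/-- The Fréchet embedding has distortion at most `|X| ^ (1 / p)` in `L_p`. -/
lemma embedsInLp_of_card_le [Fintype X] {p : ℝ≥0∞} (hp : 1 ≤ p) (hp' : p ≠ ∞) {α : ℝ}
    (hα : 0 ≤ α) (hcard : (Fintype.card X : ℝ) ≤ α ^ p.toReal) (Y : Finset X) :
    EmbedsInLp p α Y := by
  have hp0 : 0 < p.toReal := ENNReal.toReal_pos (by positivity) hp'
  refine embedsInLp_of_coords hp hp' hα one_pos (ι := X) (fun _ => 1) (fun _ => zero_le_one)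
    (fun u i => dist (u : X) i) ?_ ?_
  · intro u v
    have := Finset.single_le_sum (f := fun i => (1 : ℝ) * |dist (u : X) i - dist (v : X) i| ^ p.toReal)
      (fun i _ => by positivity) (Finset.mem_univ (v : X))
    refine le_trans ?_ this
    simp [Subtype.dist_eq]
  · intro u v
    calc ∑ i, (1 : ℝ) * |dist (u : X) i - dist (v : X) i| ^ p.toReal
        ≤ ∑ _i : X, dist u v ^ p.toReal := by
          refine Finset.sum_le_sum fun i _ => ?_
          rw [one_mul]
          exact Real.rpow_le_rpow (abs_nonneg _) (abs_dist_sub_le _ _ _) hp0.le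
      _ = Fintype.card X * dist u v ^ p.toReal := by simp
      _ ≤ _ := by
          rw [one_mul, Real.mul_rpow hα dist_nonneg]
          gcongr

lemma embedsInLp_singleton {p : ℝ≥0∞} (x : X) (α : ℝ) : EmbedsInLp p α {x} := by
  refine ⟨fun _ => 0, 1, one_pos, fun u v => ?_⟩
  have : u = v := Subsingleton.elim u v
  simp [this]

end Embedding

/-! ### Padded partitions and truncated distances -/

section Padded

variable {X : Type*} [MetricSpace X]

/-- The distance to the complement of `A`, truncated at `Δ`. -/
noncomputable def truncDist (Δ : ℝ) (A : Set X) (x : X) : ℝ :=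
  min Δ (Metric.infDist x Aᶜ)

lemma abs_truncDist_sub_le_dist (Δ : ℝ) (A : Set X) (x y : X) :
    |truncDist Δ A x - truncDist Δ A y| ≤ dist x y := by
  refine (abs_min_sub_min_le_max _ _ _ _).trans ?_
  rw [sub_self, abs_zero, max_eq_right (abs_nonneg _), ← Real.dist_eq]
  simpa using (Metric.lipschitz_infDist_pt Aᶜ).dist_le_mul x y

lemma truncDist_nonneg {Δ : ℝ} (hΔ : 0 ≤ Δ) (A : Set X) (x : X) : 0 ≤ truncDist Δ A x :=
  le_min hΔ Metric.infDist_nonneg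

lemma abs_truncDist_sub_le {Δ : ℝ} (hΔ : 0 ≤ Δ) (A : Set X) (x y : X) :
    |truncDist Δ A x - truncDist Δ A y| ≤ Δ := by
  have hx := truncDist_nonneg hΔ A x
  have hy := truncDist_nonneg hΔ A y
  have hx' : truncDist Δ A x ≤ Δ := min_le_left _ _
  have hy' : truncDist Δ A y ≤ Δ := min_le_left _ _
  rw [abs_le]
  constructor <;> linarith

lemma truncDist_of_notMem {Δ : ℝ} (hΔ : 0 ≤ Δ) {A : Set X} {x : X} (hx : x ∉ A) :
    truncDist Δ A x = 0 := by
  rw [truncDist, Metric.infDist_zero_of_mem (by exact hx), min_eq_right hΔ]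

lemma div_le_truncDist {Δ τ : ℝ} (hΔ : 0 ≤ Δ) (hτ : 1 ≤ τ) {A : Set X} {x y : X}
    (hy : y ∉ A) (hA : Metric.closedBall x (Δ / τ) ⊆ A) : Δ / τ ≤ truncDist Δ A x := by
  refine le_min (div_le_self hΔ hτ) ?_
  -- The point `y` is needed: for an empty complement `Metric.infDist` has the default value 0.
  rw [Metric.le_infDist ⟨y, hy⟩]
  intro z hz
  by_contra! h
  exact hz (hA (by rw [Metric.mem_closedBall, dist_comm]; exact h.le))

instance [Finite X] : Finite (Setoid X) :=
  Finite.of_injective (fun s : Setoid X => s.r) fun _ _ h => Setoid.ext fun a b => by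
    simpa using congrFun (congrFun h a) b

open Classical in
/-- A padded random partition yields a weight on clusters for which the truncated distances to the
complements of the clusters separate the points at distance more than `Δ`. -/
lemma exists_cluster_weight [Fintype X] {P : PMF (Setoid X)} {Δ τ : ℝ} (hΔ : 0 < Δ) (hτ : 1 ≤ τ)
    (hP : IsPaddedPartition P Δ τ) :
    ∃ q : Set X → ℝ, (∀ A, 0 ≤ q A) ∧ ∀ p : ℝ, 1 ≤ p →
      (∀ x y c, (∀ A, |truncDist Δ A x - truncDist Δ A y| ≤ c) →
        ∑ A, q A * |truncDist Δ A x - truncDist Δ A y| ^ p ≤ 2 * c ^ p) ∧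
      (∀ x y, Δ < dist x y →
        1 / 2 * (Δ / τ) ^ p ≤ ∑ A, q A * |truncDist Δ A x - truncDist Δ A y| ^ p) := by
  have : Fintype (Setoid X) := Fintype.ofFinite _
  let cl : Setoid X → X → Set X := fun s x => {y | s x y}
  have hPsum : ∑ s, (P s).toReal = 1 := by
    rw [← ENNReal.toReal_sum (fun s _ => P.apply_ne_top s), ← tsum_fintype (L := .unconditional _), P.tsum_coe,
      ENNReal.toReal_one]
  let ind : Setoid X → Set X → ℝ := fun s A => if ∃ z, A = cl s z then 1 else 0
  have hind : ∀ s A, 0 ≤ ind s A := fun s A => by simp only [ind]; split_ifs <;> norm_num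
  have hswap : ∀ (p : ℝ) x y, ∑ A, (∑ s, (P s).toReal * ind s A) *
      |truncDist Δ A x - truncDist Δ A y| ^ p =
      ∑ s, (P s).toReal * ∑ A, ind s A * |truncDist Δ A x - truncDist Δ A y| ^ p := by
    intro p x y
    simp_rw [Finset.sum_mul, Finset.mul_sum]
    rw [Finset.sum_comm]
    simp_rw [mul_assoc]
  have hmem : ∀ s x z, x ∈ cl s z → cl s z = cl s x := by
    intro s x z h
    ext y
    exact ⟨fun h' => s.trans (s.symm h) h', fun h' => s.trans h h'⟩
  refine ⟨fun A => ∑ s, (P s).toReal * ind s A, fun A => Finset.sum_nonneg fun s _ =>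
    mul_nonneg ENNReal.toReal_nonneg (hind s A), fun p hp => ⟨?_, ?_⟩⟩
  · intro x y c hc
    have hp0 : p ≠ 0 := by positivity
    have hc0 : 0 ≤ c := (abs_nonneg _).trans (hc ∅)
    simp only [hswap]
    -- In one partition only the clusters of `x` and of `y` contribute, because the truncated
    -- distance vanishes off its cluster. Hence the factor 2, independent of the number of clusters.
    have hs : ∀ s, ∑ A, ind s A * |truncDist Δ A x - truncDist Δ A y| ^ p ≤ 2 * c ^ p := by
      intro s
      rw [← Finset.sum_subset (Finset.subset_univ {cl s x, cl s y})]
      · calc _ ≤ ∑ A ∈ ({cl s x, cl s y} : Finset (Set X)), c ^ p := by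
              refine Finset.sum_le_sum fun A _ => ?_
              refine (mul_le_of_le_one_left (by positivity) ?_).trans
                (Real.rpow_le_rpow (abs_nonneg _) (hc A) (by positivity))
              simp only [ind]
              split_ifs <;> norm_num
          _ ≤ _ := by
              rw [Finset.sum_const, nsmul_eq_mul]
              gcongr
              exact_mod_cast Finset.card_le_two
      · intro A _ hA
        by_cases h : ∃ z, A = cl s z
        · obtain ⟨z, rfl⟩ := h
          have hx : x ∉ cl s z := fun h => hA (by simp [hmem s x z h])
          have hy : y ∉ cl s z := fun h => hA (by simp [hmem s y z h])
          simp [truncDist_of_notMem hΔ.le hx, truncDist_of_notMem hΔ.le hy, Real.zero_rpow hp0]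
        · simp [ind, h]
    calc _ ≤ ∑ s, (P s).toReal * (2 * c ^ p) :=
          Finset.sum_le_sum fun s _ => mul_le_mul_of_nonneg_left (hs s) ENNReal.toReal_nonneg
      _ = _ := by rw [← Finset.sum_mul, hPsum, one_mul]
  · intro x y hxy
    simp only [hswap]
    -- The event that `x` is padded. On it the cluster of `x` alone contributes `(Δ/τ) ^ p`: it
    -- contains the ball around `x` but, its diameter being at most `Δ`, not `y`.
    set G : Set (Setoid X) := {s | ∀ y ∈ Metric.closedBall x (Δ / τ), s x y} with hG
    have hpad : (1 / 2 : ℝ) ≤ ∑ s, if s ∈ G then (P s).toReal else 0 := by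
      have h : 1 / 2 ≤ P.toOuterMeasure G := hP.2 x
      rw [PMF.toOuterMeasure_apply, tsum_fintype] at h
      have htop : ∀ s ∈ Finset.univ, G.indicator P s ≠ ∞ := fun s _ =>
        ne_top_of_le_ne_top (P.apply_ne_top s) (Set.indicator_le_self G P s)
      have h' := ENNReal.toReal_mono (ENNReal.sum_ne_top.2 htop) h
      rw [ENNReal.toReal_sum htop] at h'
      refine le_trans (by norm_num) (h'.trans (le_of_eq (Finset.sum_congr rfl fun s _ => ?_)))
      by_cases hs : s ∈ G
      · rw [Set.indicator_of_mem hs, if_pos hs]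
      · rw [Set.indicator_of_notMem hs, if_neg hs, ENNReal.toReal_zero]
    calc 1 / 2 * (Δ / τ) ^ p ≤ (∑ s, if s ∈ G then (P s).toReal else 0) * (Δ / τ) ^ p := by
          gcongr
      _ = ∑ s, (if s ∈ G then (P s).toReal else 0) * (Δ / τ) ^ p := Finset.sum_mul _ _ _
      _ ≤ _ := by
          refine Finset.sum_le_sum fun s _ => ?_
          have hnn : ∀ A ∈ Finset.univ, 0 ≤ ind s A * |truncDist Δ A x - truncDist Δ A y| ^ p :=
            fun A _ => mul_nonneg (hind s A) (by positivity)
          by_cases hs : s ∈ G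
          · by_cases hs0 : P s = 0
            · simp [hs0]
            rw [if_pos hs]
            refine mul_le_mul_of_nonneg_left ?_ ENNReal.toReal_nonneg
            refine le_trans ?_ (Finset.single_le_sum hnn (Finset.mem_univ (cl s x)))
            have hy : y ∉ cl s x := fun h => hxy.not_ge (hP.1 s (P.mem_support_iff s |>.2 hs0) x y h)
            have h1 : ind s (cl s x) = 1 := if_pos ⟨x, rfl⟩
            rw [h1, one_mul, truncDist_of_notMem hΔ.le hy, sub_zero]
            refine Real.rpow_le_rpow (by positivity) ?_ (by positivity)
            exact (div_le_truncDist hΔ.le hτ hy hs).trans (le_abs_self _)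
          · rw [if_neg hs, zero_mul]
            exact mul_nonneg ENNReal.toReal_nonneg (Finset.sum_nonneg hnn)

/-- Every finite metric space is decomposable. -/
lemma exists_isDecomposable (X : Type*) [MetricSpace X] [Finite X] :
    ∃ τ : ℝ, 1 ≤ τ ∧ IsDecomposable X τ := by
  have : Fintype X := Fintype.ofFinite X
  obtain ⟨D, hD⟩ : ∃ D : ℝ, ∀ z : X × X, dist z.1 z.2 ≤ D := by
    obtain ⟨D, hD⟩ := (Set.finite_range fun z : X × X => dist z.1 z.2).bddAbove
    exact ⟨D, fun z => hD ⟨z, rfl⟩⟩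
  obtain ⟨E, hE⟩ : ∃ E : ℝ, ∀ z : X × X, (dist z.1 z.2)⁻¹ ≤ E := by
    obtain ⟨D, hD⟩ := (Set.finite_range fun z : X × X => (dist z.1 z.2)⁻¹).bddAbove
    exact ⟨D, fun z => hD ⟨z, rfl⟩⟩
  -- `D * E` bounds the aspect ratio. If `Δ ≥ D` a single cluster works; otherwise balls of radius
  -- `Δ / τ` are single points and the discrete partition works.
  refine ⟨max 1 (D * E), le_max_left _ _, fun Δ hΔ => ?_⟩
  by_cases h : D ≤ Δ
  · refine ⟨PMF.pure ⊤, fun s hs x y _ => (hD (x, y)).trans h, fun x => ?_⟩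
    rw [PMF.toOuterMeasure_pure_apply, if_pos]
    · simp
    · intro y _
      trivial
  · push Not at h
    refine ⟨PMF.pure ⊥, fun s hs x y hxy => ?_, fun x => ?_⟩
    · rw [PMF.support_pure, Set.mem_singleton_iff] at hs
      subst hs
      have : x = y := hxy
      simp [this, hΔ.le]
    · rw [PMF.toOuterMeasure_pure_apply, if_pos]
      · simp
      · intro y hy
        show x = y
        by_contra hne
        have hd : 0 < dist y x := dist_pos.2 (Ne.symm hne)
        rw [Metric.mem_closedBall, le_div_iff₀ (by positivity)] at hy
        have h1 : D * E ≤ max 1 (D * E) := le_max_right _ _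
        have h2 : 1 ≤ dist y x * E := by
          have := mul_le_mul_of_nonneg_left (hE (y, x)) hd.le
          rwa [mul_inv_cancel₀ hd.ne'] at this
        have h3 : dist y x * (D * E) ≤ Δ := (mul_le_mul_of_nonneg_left h1 hd.le).trans hy
        nlinarith [hΔ.trans h]

lemma one_le_decomposabilityParameter (X : Type*) [MetricSpace X] [Finite X] :
    1 ≤ decomposabilityParameter X :=
  le_csInf (exists_isDecomposable X) fun _ h => h.1

/-- The factor 2 avoids asking whether the infimum is attained. -/
lemma exists_isDecomposable_le (X : Type*) [MetricSpace X] [Finite X] :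
    ∃ τ : ℝ, 1 ≤ τ ∧ τ ≤ 2 * decomposabilityParameter X ∧ IsDecomposable X τ := by
  have h1 := one_le_decomposabilityParameter X
  obtain ⟨τ, hτ, hlt⟩ := exists_lt_of_csInf_lt (exists_isDecomposable X)
    (show decomposabilityParameter X < 2 * decomposabilityParameter X by linarith)
  exact ⟨τ, hτ.1, hlt.le, hτ.2⟩

end Padded

/-! ### Ball carving and heavy subsets with gaps -/

lemma prod_range_succ_div {f : ℕ → ℝ} (hf : ∀ l, f l ≠ 0) (N : ℕ) :
    ∏ l ∈ Finset.range N, f (l + 1) / f l = f N / f 0 := by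
  induction N with
  | zero => simp [hf 0]
  | succ N ih =>
    have := hf N
    rw [Finset.prod_range_succ, ih]
    field_simp

section Ramsey

variable {X : Type*} [MetricSpace X] [Fintype X]

/-- The `w`-weight of the closed ball of radius `r` around `x`. -/
noncomputable def ballWeight (w : X → ℝ) (x : X) (r : ℝ) : ℝ :=
  ∑ c, if dist x c ≤ r then w c else 0

lemma le_ballWeight {w : X → ℝ} (hw : ∀ x, 0 < w x) (x : X) {r : ℝ} (hr : 0 ≤ r) :
    w x ≤ ballWeight w x r := by
  have := Finset.single_le_sum (f := fun c => if dist x c ≤ r then w c else 0)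
    (fun c _ => by split_ifs; exacts [(hw c).le, le_rfl]) (Finset.mem_univ x)
  simpa [hr, ballWeight] using this

lemma ballWeight_le {w : X → ℝ} (hw : ∀ x, 0 < w x) (x : X) (r : ℝ) :
    ballWeight w x r ≤ ∑ c, w c := by
  refine Finset.sum_le_sum fun c _ => ?_
  split_ifs
  exacts [le_rfl, (hw c).le]

/-- Double counting for ball carving: up to normalisation, this is the expected `g`-mass in the ball
around a random centre `c` drawn with weight `w`. -/
lemma sum_ballWeight_mul (w : X → ℝ) (r : ℝ) (U : Finset X) (g : X → ℝ) :
    ∑ c, w c * ∑ x ∈ U with dist x c ≤ r, g x = ∑ x ∈ U, g x * ballWeight w x r := by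
  simp_rw [ballWeight, Finset.mul_sum, Finset.sum_filter]
  rw [Finset.sum_comm]
  refine Finset.sum_congr rfl fun x _ => Finset.sum_congr rfl fun c _ => ?_
  split_ifs <;> ring

/-- Ball carving at one scale: one can keep a set all of whose distances are at most `2 r` or more
than `R - r`, losing at each point at most the growth of the ball weight. -/
lemma exists_gap_subset {w h : X → ℝ} (hw : ∀ x, 0 < w x) {r R : ℝ}
    (hr : 0 ≤ r) (hrR : r ≤ R) (U : Finset X) :
    ∃ T ⊆ U, (∀ x ∈ T, ∀ y ∈ T, dist x y ≤ 2 * r ∨ R - r < dist x y) ∧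
      ∑ x ∈ U, h x * (ballWeight w x r / ballWeight w x R) ≤ ∑ x ∈ T, h x := by
  classical
  induction U using Finset.strongInduction with
  | H U ih =>
  rcases U.eq_empty_or_nonempty with rfl | ⟨x₀, hx₀⟩
  · exact ⟨∅, subset_rfl, by simp, by simp⟩
  set ρ : X → ℝ := fun x => ballWeight w x r / ballWeight w x R with hρ
  have hR : 0 ≤ R := hr.trans hrR
  obtain ⟨c, hc, hcsum⟩ : ∃ c, (∃ x ∈ U, dist x c ≤ R) ∧
      ∑ x ∈ U with dist x c ≤ R, h x * ρ x ≤ ∑ x ∈ U with dist x c ≤ r, h x := by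
    -- Averaging over centres `c` with weight `w c`: both sides become `∑ h x * ballWeight w x r`,
    -- so strict failure at every centre is impossible. Centres whose `R`-ball misses `U` contribute
    -- zero to both sides; `x₀` supplies the strict inequality.
    by_contra! hcon
    have hle : ∀ c, w c * ∑ x ∈ U with dist x c ≤ r, h x ≤
        w c * ∑ x ∈ U with dist x c ≤ R, h x * ρ x := by
      intro c
      by_cases hc : ∃ x ∈ U, dist x c ≤ R
      · exact mul_le_mul_of_nonneg_left (hcon c hc).le (hw c).le
      · push Not at hc
        rw [Finset.filter_false_of_mem (fun x hx => by linarith [hc x hx]),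
          Finset.filter_false_of_mem (fun x hx => by linarith [hc x hx])]
        simp
    have hlt := Finset.sum_lt_sum (s := Finset.univ) (fun c _ => hle c)
      ⟨x₀, Finset.mem_univ _, mul_lt_mul_of_pos_left
        (hcon x₀ ⟨x₀, hx₀, by simpa using hR⟩) (hw x₀)⟩
    rw [sum_ballWeight_mul, sum_ballWeight_mul] at hlt
    refine hlt.ne (Finset.sum_congr rfl fun x _ => ?_)
    have : ballWeight w x R ≠ 0 := ((hw x).trans_le (le_ballWeight hw x hR)).ne'
    simp only [hρ]
    field_simp
  obtain ⟨x₁, hx₁, hx₁c⟩ := hc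
  -- Keep the `r`-ball around `c`, discard the annulus up to `R`, and recurse outside the `R`-ball.
  obtain ⟨T, hTU, hT, hTsum⟩ := ih (U.filter fun x => ¬ dist x c ≤ R)
    (Finset.filter_ssubset.2 ⟨x₁, hx₁, by simpa using hx₁c⟩)
  have hdisj : Disjoint (U.filter fun x => dist x c ≤ r) T := by
    rw [Finset.disjoint_left]
    intro x hx hxT
    have h1 := (Finset.mem_filter.1 hx).2
    have h2 := (Finset.mem_filter.1 (hTU hxT)).2
    exact h2 (h1.trans hrR)
  have hcross : ∀ x ∈ U.filter (fun x => dist x c ≤ r), ∀ y ∈ T, R - r < dist x y := by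
    intro x hx y hy
    have h1 := (Finset.mem_filter.1 hx).2
    have h2 := not_le.1 (Finset.mem_filter.1 (hTU hy)).2
    have := dist_triangle y x c
    rw [dist_comm y x] at this
    linarith
  refine ⟨(U.filter fun x => dist x c ≤ r) ∪ T, Finset.union_subset (Finset.filter_subset _ _)
    (hTU.trans (Finset.filter_subset _ _)), ?_, ?_⟩
  · intro x hx y hy
    rcases Finset.mem_union.1 hx with hx | hx <;> rcases Finset.mem_union.1 hy with hy | hy
    · left
      have h1 := (Finset.mem_filter.1 hx).2
      have h2 := (Finset.mem_filter.1 hy).2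
      linarith [dist_triangle_right x y c]
    · exact Or.inr (hcross x hx y hy)
    · rw [dist_comm]
      exact Or.inr (hcross y hy x hx)
    · exact hT x hx y hy
  · rw [Finset.sum_union hdisj, ← Finset.sum_filter_add_sum_filter_not U (fun x => dist x c ≤ R)]
    exact add_le_add hcsum hTsum

lemma ballWeight_div_nonneg {w : X → ℝ} (hw : ∀ x, 0 < w x) (x : X) {r R : ℝ} (hr : 0 ≤ r)
    (hR : 0 ≤ R) : 0 ≤ ballWeight w x r / ballWeight w x R :=
  div_nonneg ((hw x).le.trans (le_ballWeight hw x hr)) ((hw x).le.trans (le_ballWeight hw x hR))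

/-- Gaps survive passing to subsets, so scales can be carved one after another. The function `h` is
arbitrary so that the induction can absorb the loss at the new scale into it. -/
lemma exists_gap_subset_multiscale {w : X → ℝ} (hw : ∀ x, 0 < w x) {r : ℕ → ℝ}
    (hr : ∀ l, 0 ≤ r l) (hanti : ∀ l, r (l + 1) ≤ r l) (S : Finset ℕ) :
    ∀ h : X → ℝ, ∃ T : Finset X,
      (∀ l ∈ S, ∀ x ∈ T, ∀ y ∈ T, dist x y ≤ 2 * r (l + 1) ∨ r l - r (l + 1) < dist x y) ∧
      ∑ x, h x * ∏ l ∈ S, (ballWeight w x (r (l + 1)) / ballWeight w x (r l)) ≤ ∑ x ∈ T, h x := by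
  classical
  induction S using Finset.induction_on with
  | empty => exact fun h => ⟨Finset.univ, by simp, by simp⟩
  | insert a S ha ih =>
    intro h
    obtain ⟨T, hT, hTsum⟩ := ih
      (fun x => h x * (ballWeight w x (r (a + 1)) / ballWeight w x (r a)))
    obtain ⟨T', hT'T, hT', hT'sum⟩ := exists_gap_subset (h := h) hw (hr (a + 1)) (hanti a) T
    refine ⟨T', ?_, le_trans (le_of_eq ?_) (hTsum.trans hT'sum)⟩
    · intro l hl x hx y hy
      rcases Finset.mem_insert.1 hl with rfl | hl
      · exact hT' x hx y hy
      · exact hT l hl x (hT'T hx) y (hT'T hy)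
    · refine Finset.sum_congr rfl fun x _ => ?_
      rw [Finset.prod_insert ha, mul_assoc]

/-- Among the residue classes modulo `m` of scales, one admits a heavy subset with gaps at all of
its scales. -/
lemma exists_heavy_gap_subset [Nonempty X] {w : X → ℝ} (hw : ∀ x, 0 < w x) {r : ℕ → ℝ}
    (hr : ∀ l, 0 ≤ r l) (hanti : ∀ l, r (l + 1) ≤ r l) (N : ℕ) {m : ℕ} (hm : 0 < m) :
    ∃ i < m, ∃ T : Finset X,
      (∀ l < N, l % m = i → ∀ x ∈ T, ∀ y ∈ T,
        dist x y ≤ 2 * r (l + 1) ∨ r l - r (l + 1) < dist x y) ∧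
      (∑ x, w x) ^ (1 - 1 / (m : ℝ)) ≤ ∑ x ∈ T, w x ^ (1 - 1 / (m : ℝ)) := by
  classical
  have hm' : (0 : ℝ) < m := by exact_mod_cast hm
  set ψ : ℝ := 1 - 1 / (m : ℝ) with hψ
  set ρ : ℕ → X → ℝ := fun l x => ballWeight w x (r (l + 1)) / ballWeight w x (r l) with hρ
  have hρ0 : ∀ l x, 0 ≤ ρ l x := fun l x => ballWeight_div_nonneg hw x (hr _) (hr _)
  set W := ∑ x, w x with hW
  have hW0 : 0 < W := Finset.sum_pos (fun x _ => hw x) Finset.univ_nonempty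
  set S : ℕ → Finset ℕ := fun i => (Finset.range N).filter fun l => l % m = i with hS
  -- Regrouped over all scales, the ratios telescope to the quotient of the ball weights at radii `r
  -- N` and `r 0`.
  have hprod : ∀ x, w x / W ≤ ∏ i ∈ Finset.range m, ∏ l ∈ S i, ρ l x := by
    intro x
    rw [Finset.prod_fiberwise_of_maps_to (fun l _ => Finset.mem_range.2 (Nat.mod_lt l hm)),
      prod_range_succ_div (f := fun l => ballWeight w x (r l))
        fun l => ((hw x).trans_le (le_ballWeight hw x (hr l))).ne']
    exact div_le_div₀ ((hw x).le.trans (le_ballWeight hw x (hr N))) (le_ballWeight hw x (hr N))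
      ((hw x).trans_le (le_ballWeight hw x (hr 0))) (ballWeight_le hw x (r 0))
  -- AM-GM over the `m` residue classes; the exponent `1/m` it produces is why `ψ = 1 - 1/m`.
  have hpt : ∀ x, (m : ℝ) * (w x * W ^ (ψ - 1)) ≤
      ∑ i ∈ Finset.range m, w x ^ ψ * ∏ l ∈ S i, ρ l x := by
    intro x
    have hamgm := Real.geom_mean_le_arith_mean_weighted (Finset.range m) (fun _ => 1 / (m : ℝ))
      (fun i => ∏ l ∈ S i, ρ l x) (fun _ _ => by positivity) (by simp [hm'.ne'])
      (fun i _ => Finset.prod_nonneg fun l _ => hρ0 l x)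
    rw [Real.finsetProd_rpow _ _ (fun i _ => Finset.prod_nonneg fun l _ => hρ0 l x),
      ← Finset.mul_sum] at hamgm
    have h1 : (w x / W) ^ (1 / (m : ℝ)) ≤ 1 / (m : ℝ) * ∑ i ∈ Finset.range m, ∏ l ∈ S i, ρ l x :=
      (Real.rpow_le_rpow (div_nonneg (hw x).le hW0.le) (hprod x) (by positivity)).trans hamgm
    have h2 : w x * W ^ (ψ - 1) = w x ^ ψ * (w x / W) ^ (1 / (m : ℝ)) := by
      rw [Real.div_rpow (hw x).le hW0.le, div_eq_mul_inv, ← Real.rpow_neg hW0.le, ← mul_assoc,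
        ← Real.rpow_add (hw x)]
      simp [hψ]
    rw [← Finset.mul_sum, h2]
    have h3 := mul_le_mul_of_nonneg_left h1 (mul_nonneg hm'.le (Real.rpow_nonneg (hw x).le ψ))
    calc _ = m * w x ^ ψ * (w x / W) ^ (1 / (m : ℝ)) := by ring
      _ ≤ _ := h3
      _ = _ := by field_simp
  -- Summed over `x`, the pointwise bound says that the average over residue classes is at least `W
  -- ^ ψ`.
  obtain ⟨i, hi, hisum⟩ : ∃ i ∈ Finset.range m, W ^ ψ ≤ ∑ x, w x ^ ψ * ∏ l ∈ S i, ρ l x := by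
    apply Finset.exists_le_of_sum_le (Finset.nonempty_range_iff.2 hm.ne')
    rw [Finset.sum_comm]
    refine le_trans (le_of_eq ?_) (Finset.sum_le_sum fun x _ => hpt x)
    rw [← Finset.mul_sum, ← Finset.sum_mul, ← hW, Real.rpow_sub_one hW0.ne']
    field_simp
    simp [mul_comm]
  obtain ⟨T, hT, hTsum⟩ := exists_gap_subset_multiscale hw hr hanti (S i) (fun x => w x ^ ψ)
  refine ⟨i, Finset.mem_range.1 hi, T, fun l hl hli => hT l ?_, hisum.trans hTsum⟩
  simp [hS, hl, hli]

end Ramsey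

/-! ### Embedding subsets with gaps -/

section GapEmbedding

variable {X : Type*} [MetricSpace X]

/-- If no distance in `Y` lies in `(2 r, 8 r]`, the clusters of diameter at most `2 r` have
representatives. -/
lemma exists_representatives {Y : Finset X} {r : ℝ} (hr : 0 ≤ r)
    (h : ∀ x ∈ Y, ∀ y ∈ Y, dist x y ≤ 2 * r ∨ 8 * r < dist x y) :
    ∃ rep : Y → X, (∀ x : Y, dist (x : X) (rep x) ≤ 2 * r) ∧
      ∀ x y : Y, dist x y ≤ 2 * r → rep x = rep y := by
  let s : Setoid Y :=
    { r := fun x y => dist x y ≤ 2 * r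
      iseqv :=
        { refl := fun x => by simpa using hr
          symm := fun {x y} hxy => by rwa [dist_comm]
          trans := fun {x y z} hxy hyz => by
            rcases h x x.2 z z.2 with hxz | hxz
            · exact hxz
            -- Here `d(x,z) ≤ 4 r`, which contradicts `8 r < d(x,z)`: the gap makes closeness
            -- transitive.
            · have := dist_triangle x y z
              rw [← Subtype.dist_eq] at hxz
              linarith } }
  refine ⟨fun x => (Quotient.out (⟦x⟧ : Quotient s) : Y), fun x => ?_, fun x y hxy => ?_⟩
  · have : s (Quotient.out (⟦x⟧ : Quotient s)) x := Quotient.mk_out x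
    exact s.symm this
  · have : (⟦x⟧ : Quotient s) = ⟦y⟧ := Quotient.sound hxy
    simp only [this]

/-- The scale of a positive number at most `2 D` in the sequence `2 D / 9 ^ l`. -/
lemma exists_scale {D d : ℝ} {N : ℕ} (hd : d ≤ 2 * D) (hN : 2 * (D / 9 ^ (N + 1)) < d) :
    ∃ k ≤ N, 2 * (D / 9 ^ (k + 1)) < d ∧ d ≤ 2 * (D / 9 ^ k) := by
  classical
  have hex : ∃ k, 2 * (D / 9 ^ (k + 1)) < d := ⟨N, hN⟩
  refine ⟨Nat.find hex, Nat.find_min' hex hN, Nat.find_spec hex, ?_⟩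
  rcases Nat.eq_zero_or_eq_succ_pred (Nat.find hex) with h0 | h0
  · simpa [h0] using hd
  · have := Nat.find_min hex (m := (Nat.find hex).pred) (by omega)
    rw [h0]
    exact not_lt.1 this

/-- By finiteness, scales below the smallest distance have their gaps automatically, so finitely
many scales suffice. -/
lemma exists_scale_bound [Finite X] (D : ℝ) :
    ∃ N : ℕ, ∀ n ≥ N, ∀ x y : X, x ≠ y → 8 * (D / 9 ^ n) < dist x y := by
  have h : Filter.Tendsto (fun n : ℕ => 8 * (D / 9 ^ n)) Filter.atTop (nhds 0) := by
    have := (tendsto_pow_atTop_nhds_zero_of_lt_one (r := (1 / 9 : ℝ)) (by norm_num)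
      (by norm_num)).const_mul (8 * D)
    simpa [div_eq_mul_inv, mul_assoc] using this
  have h' : ∀ x y : X, ∀ᶠ n in Filter.atTop, x ≠ y → 8 * (D / 9 ^ n) < dist x y := by
    intro x y
    by_cases hxy : x = y
    · simp [hxy]
    · filter_upwards [h.eventually_lt_const (dist_pos.2 hxy)] with n hn _ using hn
  simpa using Filter.eventually_all.2 fun x => Filter.eventually_all.2 (h' x)

/-- Bookkeeping for a pair at distance `d` and scale `k`: at most `m` middle scales cost `2 (3 d) ^
p` each and the finer ones form a geometric series of total at most `2 d ^ p`. Together this is at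
most `4 m (3 d) ^ p`, and `4 ≤ 4 ^ p`. -/
lemma sum_le_of_scale_bounds {S : ℕ → ℝ} {N m k : ℕ} {d p : ℝ} (hp : 1 ≤ p) (hm : 0 < m)
    (hd : 0 ≤ d) (h0 : ∀ l < N, l + m ≤ k → S l ≤ 0)
    (h1 : ∀ l < N, l ≤ k → k < l + m → S l ≤ 2 * (3 * d) ^ p)
    (h2 : ∀ l < N, k < l → S l ≤ 2 * (d * (9 ^ k * (1 / 9) ^ l)) ^ p) :
    ∑ l ∈ Finset.range N, S l ≤ m * (12 * d) ^ p := by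
  have hp0 : 0 ≤ p := by linarith
  have hdp : 0 ≤ d ^ p := Real.rpow_nonneg hd p
  have hm1 : (1 : ℝ) ≤ m := by exact_mod_cast hm
  -- If `k + 1 < m`, truncated subtraction starts the interval at 0, and it still has at most `m`
  -- elements.
  set I₁ := Finset.Ico (k + 1 - m) (k + 1)
  set I₂ := Finset.Ico (k + 1) N
  have hle : ∀ l ∈ Finset.range N, S l ≤ (if l ∈ I₁ then 2 * (3 * d) ^ p else 0) +
      (if l ∈ I₂ then 2 * d ^ p * (9 ^ k * (1 / 9) ^ l) else 0) := by
    intro l hl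
    have hl := Finset.mem_range.1 hl
    rcases le_or_gt (l + m) k with hk | hk
    · refine (h0 l hl hk).trans (add_nonneg ?_ ?_) <;> split_ifs <;> positivity
    rcases le_or_gt l k with hk' | hk'
    · rw [if_pos (Finset.mem_Ico.2 ⟨by omega, by omega⟩)]
      refine (h1 l hl hk' hk).trans (le_add_of_nonneg_right ?_)
      split_ifs <;> positivity
    · rw [if_pos (Finset.mem_Ico.2 ⟨by omega, hl⟩ : l ∈ I₂)]
      refine ((h2 l hl hk').trans ?_).trans (le_add_of_nonneg_left ?_)
      · rw [Real.mul_rpow hd (by positivity), ← mul_assoc]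
        gcongr
        have hle1 : (9 : ℝ) ^ k * (1 / 9) ^ l ≤ 1 := by
          rw [one_div, inv_pow, ← div_eq_mul_inv, div_le_one (by positivity)]
          exact pow_le_pow_right₀ (by norm_num) hk'.le
        exact (Real.rpow_le_rpow_of_exponent_ge (by positivity) hle1 hp).trans
          (Real.rpow_one _).le
      · split_ifs <;> positivity
  have hs1 : ∑ l ∈ Finset.range N, (if l ∈ I₁ then 2 * (3 * d) ^ p else 0) ≤
      m * (2 * (3 * d) ^ p) := by
    rw [Finset.sum_ite_mem, Finset.sum_const, nsmul_eq_mul]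
    gcongr
    refine (Finset.card_le_card Finset.inter_subset_right).trans ?_
    rw [Nat.card_Ico]
    omega
  have hs2 : ∑ l ∈ Finset.range N, (if l ∈ I₂ then 2 * d ^ p * (9 ^ k * (1 / 9) ^ l) else 0) ≤
      2 * d ^ p := by
    rw [Finset.sum_ite_mem, ← Finset.mul_sum, ← Finset.mul_sum]
    refine mul_le_of_le_one_right (by positivity) ?_
    calc (9 : ℝ) ^ k * ∑ l ∈ Finset.range N ∩ I₂, (1 / 9) ^ l
        ≤ 9 ^ k * ∑ l ∈ I₂, (1 / 9) ^ l := by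
          gcongr
          exact Finset.inter_subset_right
      _ ≤ 9 ^ k * ((1 / 9) ^ (k + 1) / (1 - 1 / 9)) := by
          gcongr
          exact geom_sum_Ico_le_of_lt_one (by norm_num) (by norm_num)
      _ ≤ 1 := by
          rw [pow_succ, one_div, inv_pow]
          field_simp
          norm_num
  have h3 : d ^ p ≤ (3 * d) ^ p := by
    gcongr
    linarith
  have h12 : 4 * (3 * d) ^ p ≤ (12 * d) ^ p := by
    rw [show 12 * d = 4 * (3 * d) by ring,
      Real.mul_rpow (x := 4) (y := 3 * d) (by norm_num) (by positivity)]
    exact mul_le_mul_of_nonneg_right (Real.self_le_rpow_of_one_le (by norm_num) hp)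
      (Real.rpow_nonneg (by positivity) p)
  calc _ ≤ _ := Finset.sum_le_sum hle
    _ ≤ m * (2 * (3 * d) ^ p) + 2 * d ^ p := by
        rw [Finset.sum_add_distrib]
        exact add_le_add hs1 hs2
    _ ≤ m * (4 * (3 * d) ^ p) := by nlinarith [Real.rpow_nonneg (by positivity : 0 ≤ 3 * d) p]
    _ ≤ _ := by gcongr

open Classical in
/-- A subset whose distances avoid the intervals `(2 r, 8 r]` at every `m`-th scale `r` embeds in
`L_p` with distortion proportional to `τ m ^ (1 / p)`. -/
lemma embedsInLp_of_gaps [Fintype X] {p : ℝ≥0∞} (hp : 1 ≤ p) (hp' : p ≠ ∞) {τ : ℝ} (hτ : 1 ≤ τ)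
    (hdec : IsDecomposable X τ) {D : ℝ} (hD : 0 < D) (hdiam : ∀ x y : X, dist x y ≤ 2 * D)
    {m i : ℕ} (hi : i < m) {Y : Finset X}
    (hY : ∀ l, l % m = i → ∀ x ∈ Y, ∀ y ∈ Y,
      dist x y ≤ 2 * (D / 9 ^ (l + 1)) ∨ 8 * (D / 9 ^ (l + 1)) < dist x y) :
    EmbedsInLp p (432 * τ * (m : ℝ) ^ (1 / p.toReal)) Y := by
  have hP := one_le_toReal hp hp'
  set P := p.toReal with hPdef
  have hP0 : 0 < P := by linarith
  have hm : 0 < m := by omega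
  have hτ0 : 0 < τ := by linarith
  set r : ℕ → ℝ := fun l => D / 9 ^ l with hr
  have hr0 : ∀ l, 0 < r l := fun l => by positivity
  have hanti : ∀ {a b}, a ≤ b → r b ≤ r a := fun {a b} hab => by
    simp only [hr]
    gcongr
    norm_num
  obtain ⟨N, hN⟩ := exists_scale_bound (X := X) D
  -- The next gap scale `j l`, found in `[l, l + m)`. Coordinates of scale `l` are evaluated at
  -- representatives of the clusters of diameter at most `2 r (j l + 1)`.
  have hj : ∀ l : ℕ, ∃ j, l ≤ j ∧ j < l + m ∧ j % m = i := by
    intro l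
    refine ⟨l + (i + (m - l % m)) % m, by omega, by have := Nat.mod_lt (i + (m - l % m)) hm; omega,
      ?_⟩
    have h1 := Nat.mod_lt l hm
    rw [Nat.add_mod_mod, ← Nat.mod_add_mod, show l % m + (i + (m - l % m)) = i + m by omega,
      Nat.add_mod_right, Nat.mod_eq_of_lt hi]
  choose j hlj hjm hji using hj
  choose rep hrep hrep' using fun l =>
    exists_representatives (hr0 (j l + 1)).le (hY (j l) (hji l))
  choose Q hQ using fun l => hdec (r (l + 1)) (hr0 _)
  choose q hq hqP using fun l => exists_cluster_weight (hr0 (l + 1)) hτ (hQ l)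
  have hqup := fun l => (hqP l P hP).1
  have hqlow := fun l => (hqP l P hP).2
  set S : ℕ → Y → Y → ℝ := fun l u v => ∑ A, q l A *
    |truncDist (r (l + 1)) A (rep l u) - truncDist (r (l + 1)) A (rep l v)| ^ P with hS
  have hS0 : ∀ l u v, 0 ≤ S l u v := fun l u v =>
    Finset.sum_nonneg fun A _ => mul_nonneg (hq l A) (by positivity)
  have hSeq : ∀ l u v, rep l u = rep l v → S l u v = 0 := by
    intro l u v h
    simp [hS, h, Real.zero_rpow hP0.ne']
  have hsum : ∀ u v : Y, ∑ a : Fin (N + 1) × Set X, q a.1 a.2 *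
      |truncDist (r (a.1 + 1)) a.2 (rep a.1 u) - truncDist (r (a.1 + 1)) a.2 (rep a.1 v)| ^ P =
      ∑ l ∈ Finset.range (N + 1), S l u v := by
    intro u v
    rw [Fintype.sum_prod_type, ← Fin.sum_univ_eq_sum_range (fun l => S l u v)]
  have hscale : ∀ u v : Y, u ≠ v → ∃ k ≤ N, 2 * r (k + 1) < dist u v ∧ dist u v ≤ 2 * r k := by
    intro u v huv
    refine exists_scale (hdiam _ _) ?_
    have := hN (N + 1) (by omega) u v (fun h => huv (Subtype.ext h))
    have h0 : 0 < D / 9 ^ (N + 1) := hr0 (N + 1)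
    rw [Subtype.dist_eq]
    linarith
  refine embedsInLp_of_coords hp hp' (ι := Fin (N + 1) × Set X) (r := 1 / (36 * τ)) (by positivity)
    (by positivity) (fun a => q a.1 a.2) (fun a => hq _ _)
    (fun u a => truncDist (r (a.1 + 1)) a.2 (rep a.1 u)) ?_ ?_
  · intro u v
    rw [hsum]
    by_cases huv : u = v
    · rw [huv, dist_self, mul_zero, Real.zero_rpow hP0.ne']
      exact Finset.sum_nonneg fun l _ => hS0 l v v
    obtain ⟨k, hkN, hk1, hk2⟩ := hscale u v huv
    refine le_trans ?_ (Finset.single_le_sum (fun l _ => hS0 l u v)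
      (Finset.mem_range.2 (Nat.lt_succ_of_le hkN)))
    have hjk : r (j k + 1) ≤ r (k + 1) := hanti (by have := hlj k; omega)
    have hgap : 8 * r (j k + 1) < dist u v := by
      rcases hY (j k) (hji k) u u.2 v v.2 with h | h
      · have h' : dist u v ≤ 2 * r (j k + 1) := h
        linarith
      · exact h
    -- Passing to representatives costs at most `4 r (j k + 1) < d / 2`, and `d / 2 > r (k + 1)`; so
    -- scale `k` still separates the pair.
    have hfar : r (k + 1) < dist (rep k u) (rep k v) := by
      have h1 := dist_triangle4 (u : X) (rep k u) (rep k v) v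
      have h2 := hrep k u
      have h3 := hrep k v
      rw [dist_comm] at h3
      rw [← Subtype.dist_eq] at h1
      linarith
    refine le_trans ?_ (hqlow k _ _ hfar)
    have hrk : r k = 9 * r (k + 1) := by
      simp only [hr, pow_succ]
      field_simp
    -- The 36 is `2 * 18`: `d ≤ 2 r k = 18 r (k + 1)`, and the factor 2 pays for the padding
    -- probability `1/2`.
    calc (1 / (36 * τ) * dist u v) ^ P ≤ (1 / 2 * (r (k + 1) / τ)) ^ P := by
          refine Real.rpow_le_rpow (by positivity) ?_ hP0.le
          rw [one_div_mul_eq_div, div_le_iff₀ (by positivity)]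
          field_simp
          linarith
      _ = (1 / 2) ^ P * (r (k + 1) / τ) ^ P :=
          Real.mul_rpow (by norm_num) (div_nonneg (hr0 _).le hτ0.le)
      _ ≤ 1 / 2 * (r (k + 1) / τ) ^ P := by
          refine mul_le_mul_of_nonneg_right ?_
            (Real.rpow_nonneg (div_nonneg (hr0 _).le hτ0.le) _)
          exact (Real.rpow_le_rpow_of_exponent_ge (by norm_num) (by norm_num) hP).trans
            (Real.rpow_one _).le
  · intro u v
    rw [hsum]
    have hd : 0 ≤ dist u v := dist_nonneg
    by_cases huv : u = v
    · subst huv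
      rw [Finset.sum_eq_zero fun l _ => hSeq l u u rfl]
      positivity
    obtain ⟨k, hkN, hk1, hk2⟩ := hscale u v huv
    -- `432 = 36 * 12`: the normalisation of the lower bound times the constant of the upper bound.
    have hα : (432 * τ * (m : ℝ) ^ (1 / P) * (1 / (36 * τ) * dist u v)) ^ P =
        m * (12 * dist u v) ^ P := by
      rw [show 432 * τ * (m : ℝ) ^ (1 / P) * (1 / (36 * τ) * dist u v) =
        (m : ℝ) ^ (1 / P) * (12 * dist u v) by field_simp; ring,
        Real.mul_rpow (by positivity) (by positivity), ← Real.rpow_mul (by positivity),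
        one_div_mul_cancel hP0.ne', Real.rpow_one]
    rw [hα]
    refine sum_le_of_scale_bounds (k := k) hP hm hd ?_ ?_ ?_
    -- Coarse scales: `j l + 1 ≤ l + m ≤ k`, so both points have the same representative.
    · intro l _ hlk
      refine (hSeq l u v (hrep' l u v (hk2.trans ?_))).le
      have : r k ≤ r (j l + 1) := hanti (by have := hjm l; omega)
      linarith
    -- Middle scales: either the representatives agree, or `2 r (j l + 1) < d` and they are at
    -- distance at most `3 d`.
    · intro l _ _ _
      rcases le_or_gt (dist u v) (2 * r (j l + 1)) with h | h
      · rw [hSeq l u v (hrep' l u v h)]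
        positivity
      · refine hqup l _ _ _ fun A => (abs_truncDist_sub_le_dist _ _ _ _).trans ?_
        have h1 := dist_triangle4 (rep l u) (u : X) v (rep l v)
        have h2 := hrep l u
        have h3 := hrep l v
        rw [dist_comm] at h2
        rw [← Subtype.dist_eq] at h1
        linarith
    -- Fine scales: truncation at `r (l + 1)` gives geometric decay.
    · intro l _ hkl
      refine hqup l _ _ _ fun A => (abs_truncDist_sub_le (hr0 _).le _ _ _).trans ?_
      have : r (l + 1) = r (k + 1) * (9 ^ k * (1 / 9) ^ l) := by
        simp only [hr, pow_succ, one_div, inv_pow]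
        field_simp
      rw [this]
      have := hr0 (k + 1)
      gcongr
      linarith

end GapEmbedding

/-! ### Bounds on the Ramsey function and large subspaces -/

section Main

variable {X : Type*} [MetricSpace X]

lemma EmbedsInLp.mono {p : ℝ≥0∞} {α β : ℝ} {Y : Finset X} (h : EmbedsInLp p α Y) (hαβ : α ≤ β) :
    EmbedsInLp p β Y := by
  obtain ⟨f, r, hr, hf⟩ := h
  exact ⟨f, r, hr, fun u v => ⟨(hf u v).1, (hf u v).2.trans
    (mul_le_mul_of_nonneg_right hαβ (mul_nonneg hr.le dist_nonneg))⟩⟩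

variable [Fintype X]

lemma le_ramseyFunction {p : ℝ≥0∞} {α ψ : ℝ} (h : ψ ∈ ramseyExponents X p α) :
    ψ ≤ ramseyFunction X p α :=
  le_csSup ⟨1, fun _ h => h.2.1⟩ h

lemma ramseyFunction_eq_one {p : ℝ≥0∞} {α : ℝ} (h : EmbedsInLp p α (Finset.univ : Finset X)) :
    ramseyFunction X p α = 1 := by
  have h1 : (1 : ℝ) ∈ ramseyExponents X p α :=
    ⟨zero_le_one, le_rfl, fun w hw => ⟨Finset.univ, h, by simp⟩⟩
  exact le_antisymm (csSup_le ⟨1, h1⟩ fun _ h => h.2.1) (le_ramseyFunction h1)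

variable [Nonempty X]

/-- The weighted Ramsey theorem with exponent `1 - 1 / m`. -/
lemma exists_heavy_embedsInLp {p : ℝ≥0∞} (hp : 1 ≤ p) (hp' : p ≠ ∞) {m : ℕ} (hm : 0 < m)
    {w : X → ℝ} (hw : ∀ x, 0 < w x) :
    ∃ Y : Finset X,
      EmbedsInLp p (864 * decomposabilityParameter X * (m : ℝ) ^ (1 / p.toReal)) Y ∧
      (∑ x, w x) ^ (1 - 1 / (m : ℝ)) ≤ ∑ x ∈ Y, w x ^ (1 - 1 / (m : ℝ)) := by
  obtain ⟨τ, hτ, hτ2, hdec⟩ := exists_isDecomposable_le X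
  obtain ⟨D, hD, hdiam⟩ : ∃ D : ℝ, 0 < D ∧ ∀ x y : X, dist x y ≤ 2 * D := by
    obtain ⟨D, hD⟩ := (Set.finite_range fun z : X × X => dist z.1 z.2).bddAbove
    refine ⟨max 1 D, by positivity, fun x y => (hD ⟨(x, y), rfl⟩).trans ?_⟩
    have h1 := le_max_left 1 D
    have h2 := le_max_right 1 D
    linarith
  obtain ⟨N, hN⟩ := exists_scale_bound (X := X) D
  have hstep : ∀ l : ℕ, D / 9 ^ l = 9 * (D / 9 ^ (l + 1)) := fun l => by
    rw [pow_succ]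
    field_simp
  have hpos : ∀ l : ℕ, 0 < D / 9 ^ l := fun l => by positivity
  obtain ⟨i, hi, Y, hY, hYsum⟩ := exists_heavy_gap_subset hw (r := fun l => D / 9 ^ l)
    (fun l => (hpos l).le) (fun l => by have := hpos (l + 1); have := hstep l; linarith) N hm
  refine ⟨Y, (embedsInLp_of_gaps hp hp' hτ hdec hD hdiam hi fun l hl x hx y hy => ?_).mono ?_, hYsum⟩
  -- Below `N` the carved gap reaches `r l - r (l + 1) = 8 r (l + 1)`, which is why the ratio of
  -- scales is 9; from `N` on every distinct pair is beyond the gap.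
  · rcases lt_or_ge l N with hlN | hlN
    · rcases hY l hlN hl x hx y hy with h | h
      · exact Or.inl h
      · right
        have := hstep l
        linarith
    · by_cases hxy : x = y
      · left
        have := hpos (l + 1)
        rw [hxy, dist_self]
        positivity
      · exact Or.inr (hN (l + 1) (by omega) x y hxy)
  · have : (0 : ℝ) ≤ (m : ℝ) ^ (1 / p.toReal) := by positivity
    nlinarith

lemma ramseyFunction_nonneg (p : ℝ≥0∞) (α : ℝ) : 0 ≤ ramseyFunction X p α := by
  obtain ⟨x⟩ := ‹Nonempty X›
  exact le_ramseyFunction ⟨le_rfl, zero_le_one, fun w hw => ⟨{x}, embedsInLp_singleton x α, by simp⟩⟩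

lemma one_sub_le_ramseyFunction {p : ℝ≥0∞} (hp : 1 ≤ p) (hp' : p ≠ ∞) {m : ℕ} (hm : 0 < m) {α : ℝ}
    (hα : 864 * decomposabilityParameter X * (m : ℝ) ^ (1 / p.toReal) ≤ α) :
    1 - 1 / (m : ℝ) ≤ ramseyFunction X p α := by
  have hm1 : (1 : ℝ) ≤ m := by exact_mod_cast hm
  refine le_ramseyFunction ⟨?_, ?_, fun w hw => ?_⟩
  · rw [sub_nonneg, div_le_one (by positivity)]
    exact hm1
  · rw [sub_le_self_iff]
    positivity
  · obtain ⟨Y, hY, hsum⟩ := exists_heavy_embedsInLp hp hp' hm hw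
    exact ⟨Y, hY.mono hα, hsum⟩

/-- The logarithmic factor in the Ramsey bounds enters only through this inequality; the estimates
are proved without it. -/
lemma half_le_mul_log {P a : ℝ} (hP : 1 ≤ P) (ha : 0 ≤ a) : 1 / 2 ≤ P * Real.log (2 + a) := by
  have h1 : Real.log 2 ≤ Real.log (2 + a) := Real.log_le_log (by norm_num) (by linarith)
  have h2 := Real.log_two_gt_d9
  nlinarith

/-- Take `m = ⌊A ^ p⌋` with `A = α / (864 τ)`, the largest `m` whose distortion is at most `α`; then
`1/m ≤ 2 / A ^ p`. If `A ^ p < 1` the bound is not positive. The constant is `3456 = 4 * 864`. -/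
lemma ramseyFunction_ge {p : ℝ≥0∞} (hp : 1 ≤ p) (hp' : p ≠ ∞) {α : ℝ} (hα : 1 < α) :
    1 - (3456 * decomposabilityParameter X / α) ^ p.toReal *
        (p.toReal * Real.log (2 + α / decomposabilityParameter X)) ≤ ramseyFunction X p α := by
  have hP := one_le_toReal hp hp'
  set P := p.toReal
  have hP0 : 0 < P := by linarith
  have hτ := one_le_decomposabilityParameter X
  set τ := decomposabilityParameter X
  have hτ0 : 0 < τ := by linarith
  have hα0 : 0 < α := by linarith
  have hlog := half_le_mul_log hP (a := α / τ) (by positivity)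
  set A := α / (864 * τ) with hA
  have hA0 : 0 < A := by positivity
  have hAP : 0 < A ^ P := by positivity
  have h4 : 2 / A ^ P ≤ (3456 * τ / α) ^ P * (P * Real.log (2 + α / τ)) := by
    have h1 : 3456 * τ / α = 4 / A := by
      rw [hA]
      field_simp
      norm_num
    have h2 : (4 : ℝ) ≤ 4 ^ P := Real.self_le_rpow_of_one_le (by norm_num) hP
    rw [h1, Real.div_rpow (by norm_num) hA0.le]
    calc 2 / A ^ P = 4 / A ^ P * (1 / 2) := by ring
      _ ≤ _ := by gcongr
  refine (sub_le_sub_left h4 1).trans ?_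
  rcases lt_or_ge (A ^ P) 1 with h | h
  · refine le_trans ?_ (ramseyFunction_nonneg p α)
    rw [sub_nonpos, le_div_iff₀ hAP]
    linarith
  · have hm : 0 < ⌊A ^ P⌋₊ := Nat.floor_pos.2 h
    refine le_trans ?_ (one_sub_le_ramseyFunction hp hp' hm (α := α) ?_)
    · have hm1 : (1 : ℝ) ≤ ⌊A ^ P⌋₊ := by exact_mod_cast hm
      have := Nat.lt_floor_add_one (A ^ P)
      gcongr 1 - ?_
      rw [div_le_div_iff₀ (by positivity) hAP]
      linarith
    · calc 864 * τ * (⌊A ^ P⌋₊ : ℝ) ^ (1 / P) ≤ 864 * τ * (A ^ P) ^ (1 / P) := by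
            gcongr
            exact Nat.floor_le hAP.le
        _ = α := by
            rw [← Real.rpow_mul hA0.le, mul_one_div_cancel hP0.ne', Real.rpow_one, hA]
            field_simp

/-- If `|X| ≤ α ^ p`, the Fréchet embedding handles all of `X`. Otherwise `|X| (τ/α) ^ p ≥ 1`,
because `τ ≥ 1`, and the bound is not positive. -/
lemma ramseyFunction_ge_of_card {p : ℝ≥0∞} (hp : 1 ≤ p) (hp' : p ≠ ∞) {α : ℝ} (hα : 1 < α) :
    1 - 2 * Fintype.card X * (decomposabilityParameter X / α) ^ p.toReal *
        (p.toReal * Real.log (2 + α / decomposabilityParameter X)) ≤ ramseyFunction X p α := by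
  have hP := one_le_toReal hp hp'
  have hτ := one_le_decomposabilityParameter X
  set P := p.toReal
  set τ := decomposabilityParameter X
  have hτ0 : 0 < τ := by linarith
  have hα0 : 0 < α := by linarith
  have hlog := half_le_mul_log hP (a := α / τ) (by positivity)
  rcases le_or_gt (Fintype.card X : ℝ) (α ^ P) with h | h
  · rw [ramseyFunction_eq_one (embedsInLp_of_card_le hp hp' hα0.le h _), sub_le_self_iff]
    have : 0 ≤ P * Real.log (2 + α / τ) := by linarith
    positivity
  · refine le_trans ?_ (ramseyFunction_nonneg p α)
    rw [sub_nonpos]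
    have h1 : 1 / α ^ P ≤ (τ / α) ^ P := by
      rw [Real.div_rpow hτ0.le hα0.le]
      gcongr
      exact Real.one_le_rpow hτ (by linarith)
    calc 1 ≤ 2 * (Fintype.card X : ℝ) * (1 / α ^ P) * (1 / 2) := by
          rw [show 2 * (Fintype.card X : ℝ) * (1 / α ^ P) * (1 / 2) = Fintype.card X / α ^ P by ring,
            one_le_div (by positivity)]
          exact h.le
      _ ≤ _ := by gcongr

lemma exists_large_embedsInLp {p : ℝ≥0∞} (hp : 1 ≤ p) {ε : ℝ} (hε : 0 < ε) :
    ∃ Y : Finset X, (Fintype.card X : ℝ) ^ (1 - ε) ≤ (Y.card : ℝ) ∧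
      EmbedsInLp p (3456 * (decomposabilityParameter X *
        (Real.log (2 + 1 / ε) / ε) ^ (p⁻¹).toReal)) Y := by
  have hτ := one_le_decomposabilityParameter X
  set τ := decomposabilityParameter X
  have hcard : (1 : ℝ) ≤ Fintype.card X := by exact_mod_cast Fintype.card_pos (α := X)
  rcases le_or_gt 1 ε with hε1 | hε1
  · obtain ⟨x⟩ := ‹Nonempty X›
    refine ⟨{x}, ?_, embedsInLp_singleton x _⟩
    rw [Finset.card_singleton, Nat.cast_one]
    exact Real.rpow_le_one_of_one_le_of_nonpos hcard (by linarith)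
  by_cases hp' : p = ∞
  · subst hp'
    refine ⟨Finset.univ, ?_, embedsInLp_top ?_ _⟩
    · rw [Finset.card_univ]
      exact (Real.rpow_le_rpow_of_exponent_le hcard (by linarith)).trans (Real.rpow_one _).le
    · simp only [ENNReal.inv_top, ENNReal.toReal_zero, Real.rpow_zero]
      linarith
  have hP := one_le_toReal hp hp'
  -- With unit weights the exponent `1 - 1/m ≥ 1 - ε` becomes a bound on cardinality. As `ε < 1`, `m
  -- < 2 / ε`, and `2 + 1/ε > e` lets the logarithm be inserted for free.
  set m := ⌈1 / ε⌉₊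
  have hm : 0 < m := Nat.ceil_pos.2 (by positivity)
  have hm0 : (0 : ℝ) < m := by exact_mod_cast hm
  have hε' : 1 < 1 / ε := by rwa [lt_div_iff₀ hε, one_mul]
  have hmle : 1 / ε ≤ m := Nat.le_ceil _
  have hmlt : (m : ℝ) < 1 / ε + 1 := Nat.ceil_lt_add_one (by positivity)
  obtain ⟨Y, hY, hsum⟩ := exists_heavy_embedsInLp (X := X) hp hp' hm (w := fun _ => 1)
    (fun _ => one_pos)
  refine ⟨Y, ?_, hY.mono ?_⟩
  · simp only [Finset.sum_const, Finset.card_univ, nsmul_eq_mul, mul_one, Real.one_rpow] at hsum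
    refine (Real.rpow_le_rpow_of_exponent_le hcard ?_).trans hsum
    have : 1 / (m : ℝ) ≤ ε := (one_div_le hm0 hε).2 hmle
    linarith
  · have hlog : 1 ≤ Real.log (2 + 1 / ε) := by
      rw [Real.le_log_iff_exp_le (by positivity)]
      have := Real.exp_one_lt_d9
      linarith
    have hm2 : (m : ℝ) ≤ 2 * (Real.log (2 + 1 / ε) / ε) := by
      have : 1 / ε ≤ Real.log (2 + 1 / ε) / ε := by gcongr
      linarith
    rw [ENNReal.toReal_inv, ← one_div]
    have h1 : (m : ℝ) ^ (1 / p.toReal) ≤ 2 * (Real.log (2 + 1 / ε) / ε) ^ (1 / p.toReal) := by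
      calc (m : ℝ) ^ (1 / p.toReal) ≤ (2 * (Real.log (2 + 1 / ε) / ε)) ^ (1 / p.toReal) := by
            gcongr
        _ = 2 ^ (1 / p.toReal) * (Real.log (2 + 1 / ε) / ε) ^ (1 / p.toReal) :=
            Real.mul_rpow (by norm_num) (by positivity)
        _ ≤ _ := by
            gcongr
            refine (Real.rpow_le_rpow_of_exponent_le (by norm_num) ?_).trans (Real.rpow_one _).le
            rw [div_le_one (by linarith)]
            exact hP
    have h2 : 0 ≤ (Real.log (2 + 1 / ε) / ε) ^ (1 / p.toReal) := by positivity
    have h3 := mul_le_mul_of_nonneg_left h1 (by linarith : (0 : ℝ) ≤ 864 * τ)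
    nlinarith [mul_nonneg (by linarith : (0 : ℝ) ≤ τ) h2]

end Main

theorem mainTheorem9 :
    ∃ C : ℝ, 0 < C ∧
      ∀ (X : Type*) [MetricSpace X] [Fintype X] [Nonempty X],
        -- the bound on the Ramsey function, with a universal constant
        (∀ (p : ℝ≥0∞), 1 ≤ p → p ≠ ∞ → ∀ α : ℝ, 1 < α →
          1 - (C * decomposabilityParameter X / α) ^ p.toReal *
              (p.toReal * Real.log (2 + α / decomposabilityParameter X))
            ≤ ramseyFunction X p α) ∧
        -- the same with the constant outside the power, depending on the space but not on `p`, `α`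
        (∃ C' : ℝ, 0 < C' ∧ ∀ (p : ℝ≥0∞), 1 ≤ p → p ≠ ∞ → ∀ α : ℝ, 1 < α →
          1 - C' * (decomposabilityParameter X / α) ^ p.toReal *
              (p.toReal * Real.log (2 + α / decomposabilityParameter X))
            ≤ ramseyFunction X p α) ∧
        -- the case `p = ∞`
        (∀ α : ℝ, 1 < α → ramseyFunction X ∞ α = 1) ∧
        -- large subspaces of small distortion, for all `1 ≤ p ≤ ∞`
        (∀ (p : ℝ≥0∞), 1 ≤ p → ∀ ε : ℝ, 0 < ε →
          ∃ Y : Finset X, (Fintype.card X : ℝ) ^ (1 - ε) ≤ (Y.card : ℝ) ∧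
            EmbedsInLp p
              (C * (decomposabilityParameter X *
                (Real.log (2 + 1 / ε) / ε) ^ (p⁻¹).toReal)) Y) := by
  refine ⟨3456, by norm_num, fun X _ _ _ => ⟨fun p hp hp' α hα => ramseyFunction_ge hp hp' hα,
    ⟨2 * Fintype.card X, by have := Fintype.card_pos (α := X); positivity,
      fun p hp hp' α hα => ramseyFunction_ge_of_card hp hp' hα⟩,
    fun α hα => ramseyFunction_eq_one (embedsInLp_top hα.le _),
    fun p hp ε hε => exists_large_embedsInLp hp hε⟩⟩
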